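/- Let $p$ be a prime number, $n\ge 2$ an integer, and $G$ a profinite group. For $k\ge 1$ let $\mathbb{U}_k$ be the group of unipotent upper-triangular $(k+1)\times(k+1)$ matrices over $\mathbb{Z}/p$, let $\bar{\mathbb{U}}_k$ be its quotient by the central subgroup $\{I+rE_{1,k+1} : r\in\mathbb{Z}/p\}\cong\mathbb{Z}/p$, and let $\alpha_k\in H^2(\bar{\mathbb{U}}_k)$ be the class of the central extension $0\to\mathbb{Z}/p\to\mathbb{U}_k\to\bar{\mathbb{U}}_k\to1$, where $H^i(\cdot)=H^i(\cdot,\mathbb{Z}/p)$ is profinite cohomology with trivial action. Let $T^{\mathbb{U}_k}(G)$ be the intersection of the kernels of all continuous homomorphisms $G\to\mathbb{U}_k$; then $T^{\mathbb{U}_n}(G)\le T^{\mathbb{U}_{n-1}}(G)$. Put $\bar G=G/T^{\mathbb{U}_{n-1}}(G)$, and let $H^2(\bar G)_{n\text{-Massey},G}$ be the subgroup of $H^2(\bar G)$ generated by all pullbacks $\bar\rho^*(\alpha_n)$, with $\bar\rho\colon\bar G\to\bar{\mathbb{U}}_n$ a continuous homomorphism, whose inflation to $H^2(G)$ is trivial.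 Theorem 9.1. (a) There is a perfect bilinear map $$\langle\cdot,\cdot\rangle\colon T^{\mathbb{U}_{n-1}}(G)/T^{\mathbb{U}_n}(G)\times H^2(\bar G)_{n\text{-Massey},G}\to\mathbb{Z}/p$$ (that is, it is continuous in the first variable, and both induced maps $A\to\mathrm{Hom}(B,\mathbb{Z}/p)$ and $B\to\mathrm{Hom}_{\rm cont}(A,\mathbb{Z}/p)$ are isomorphisms, where $A$ is the first factor and $B$ the second), given by transgression: for every $x\in H^2(\bar G)_{n\text{-Massey},G}$ and every continuous homomorphism $\psi\colon T^{\mathbb{U}_{n-1}}(G)\to\mathbb{Z}/p$, the homomorphism $\psi$ is $G$-invariant with $\mathrm{trg}(\psi)=x$ if and only if $\langle\bar\sigma,x\rangle=\psi(\sigma)$ for all $\sigma\in T^{\mathbb{U}_{n-1}}(G)$, where $\bar\sigma$ is the coset of $\sigma$ and $\mathrm{trg}\colon H^1(T^{\mathbb{U}_{n-1}}(G))^G\to H^2(\bar G)$ is the transgression. (b) There is an exact sequence $$0\to H^2(\bar G)_{n\text{-Massey},G}\hookrightarrow H^2(\bar G)\xrightarrow{\ \inf\ }H^2(G/T^{\mathbb{U}_n}(G)).$$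 -/

import Mathlib

/-! ### Continuous cohomology in degree two, with trivial action -/

section Cohomology

variable (G : Type*) [Group G] [TopologicalSpace G]
variable (A : Type*) [AddCommGroup A] [TopologicalSpace A] [IsTopologicalAddGroup A]

/-- Continuous inhomogeneous `2`-cocycles of `G` with values in `A`, for the trivial action. -/
def contCocycles₂ : AddSubgroup (G × G → A) where
  carrier := {f | Continuous f ∧
    ∀ g h j : G, f (g * h, j) + f (g, h) = f (h, j) + f (g, h * j)}
  zero_mem' := ⟨continuous_const, fun _ _ _ => rfl⟩
  add_mem' := by
    rintro a b ⟨ha, ha'⟩ ⟨hb, hb'⟩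
    refine ⟨ha.add hb, fun g h j => ?_⟩
    simp only [Pi.add_apply]
    rw [add_add_add_comm, ha', hb', add_add_add_comm]
  neg_mem' := by
    rintro a ⟨ha, ha'⟩
    refine ⟨ha.neg, fun g h j => ?_⟩
    simp only [Pi.neg_apply]
    rw [← neg_add, ha', neg_add]

/-- Continuous inhomogeneous `2`-coboundaries: the coboundaries of continuous `1`-cochains. -/
def contCoboundaries₂ : AddSubgroup (G × G → A) where
  carrier := {f | ∃ y : G → A, Continuous y ∧ ∀ g h : G, f (g, h) = y h - y (g * h) + y g}
  zero_mem' := ⟨0, continuous_const, fun _ _ => by simp⟩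
  add_mem' := by
    rintro a b ⟨y, hy, ha⟩ ⟨z, hz, hb⟩
    refine ⟨y + z, hy.add hz, fun g h => ?_⟩
    simp only [Pi.add_apply, ha, hb]
    abel
  neg_mem' := by
    rintro a ⟨y, hy, ha⟩
    refine ⟨-y, hy.neg, fun g h => ?_⟩
    simp only [Pi.neg_apply, ha]
    abel

/-- The second continuous (profinite, if `G` is profinite) cohomology group `H²(G, A)` with
trivial action: continuous cocycles modulo coboundaries of continuous cochains. -/
abbrev contH2 : Type _ :=
  contCocycles₂ G A ⧸ (contCoboundaries₂ G A).addSubgroupOf (contCocycles₂ G A)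

variable {G}

/-- The cohomology class of a continuous `2`-cocycle. -/
abbrev contH2.mk : contCocycles₂ G A →+ contH2 G A :=
  QuotientAddGroup.mk' _

variable {H : Type*} [Group H] [TopologicalSpace H]

/-- Pullback of continuous `2`-cocycles along a continuous homomorphism. -/
def contCocycles₂.map (φ : G →ₜ* H) : contCocycles₂ H A →+ contCocycles₂ G A where
  toFun f := ⟨fun x => f.1 (φ x.1, φ x.2), by
    refine ⟨f.2.1.comp ?_, fun g h j => ?_⟩
    · exact ((map_continuous φ).comp continuous_fst).prodMk
        ((map_continuous φ).comp continuous_snd)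
    · simpa only [map_mul] using f.2.2 (φ g) (φ h) (φ j)⟩
  map_zero' := rfl
  map_add' _ _ := rfl

/-- The homomorphism `φ^* : H²(H, A) → H²(G, A)` induced by a continuous homomorphism
`φ : G → H`. -/
def contH2.map (φ : G →ₜ* H) : contH2 H A →+ contH2 G A :=
  QuotientAddGroup.map _ _ (contCocycles₂.map A φ) (by
    rintro f ⟨y, hy, hf⟩
    refine ⟨y ∘ φ, hy.comp (map_continuous φ), fun g h => ?_⟩
    refine (hf (φ g) (φ h)).trans ?_
    simp only [Function.comp, map_mul])

end Cohomology

/-! ### Quotient maps and transgression -/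

section Quotients

variable {G : Type*} [Group G] [TopologicalSpace G]

/-- The natural projection `G → G/N`, as a continuous homomorphism. -/
def quotProj (N : Subgroup G) [N.Normal] : G →ₜ* G ⧸ N where
  toMonoidHom := QuotientGroup.mk' N
  continuous_toFun := continuous_quotient_mk'

/-- The natural projection `G/N₁ → G/N₂` for `N₁ ≤ N₂`, as a continuous homomorphism. -/
def quotMap {N₁ N₂ : Subgroup G} [N₁.Normal] [N₂.Normal] (h : N₁ ≤ N₂) : G ⧸ N₁ →ₜ* G ⧸ N₂ where
  toMonoidHom := QuotientGroup.map N₁ N₂ (MonoidHom.id G) h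
  continuous_toFun := Continuous.quotient_lift continuous_quotient_mk' _

variable {A : Type*} [AddCommGroup A] [TopologicalSpace A] [IsTopologicalAddGroup A]

/-- `x ∈ H²(G/N, A)` is the transgression of the continuous homomorphism `ψ : N → A` (invariant
under conjugation by `G`): some continuous cochain `y : G → A` extends `ψ`, and its coboundary
depends only on cosets modulo `N` and is, as a cocycle of `G/N`, a representative of `x`. -/
def IsTransgression (N : Subgroup G) [N.Normal] (ψ : N →ₜ* Multiplicative A)
    (x : contH2 (G ⧸ N) A) : Prop :=
  (∀ (g : G) (σ : N), ψ (MulAut.conjNormal g σ) = ψ σ) ∧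
  ∃ (y : G → A) (c : contCocycles₂ (G ⧸ N) A),
    Continuous y ∧
    (∀ σ : N, y σ = (ψ σ).toAdd) ∧
    (∀ g h : G, c.1 ((g : G ⧸ N), (h : G ⧸ N)) = y h - y (g * h) + y g) ∧
    contH2.mk A c = x

end Quotients

/-! ### Perfect bilinear maps -/

/-- A bilinear map `A × B → Z` is perfect if the induced homomorphisms `A → Hom(B, Z)` and
`B → Hom_cont(A, Z)` are both (well defined and) bijective.  Here `A` is a topological (profinite)
group, and `B` is a discrete abelian group. -/
structure IsPerfectPairing {A B Z : Type*} [AddGroup A] [TopologicalSpace A] [AddCommGroup B]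
    [AddCommGroup Z] [TopologicalSpace Z] (β : A →+ B →+ Z) : Prop where
  continuous_left : ∀ b : B, Continuous fun a => β a b
  bijective_left : Function.Bijective fun a : A => β a
  bijective_right : Function.Bijective fun b : B =>
    (⟨β.flip b, continuous_left b⟩ : A →ₜ+ Z)

/-! ### The subgroups `T^U(G)` -/

section KernelIntersection

variable (U : Type*) [Group U] [TopologicalSpace U] (G : Type*) [Group G] [TopologicalSpace G]

/-- `T^U(G)`: the intersection of the kernels of all continuous homomorphisms `G → U`. -/
def kernelInter : Subgroup G :=
  ⨅ ρ : G →ₜ* U, (ρ : G →* U).ker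

instance kernelInter_normal : (kernelInter U G).Normal :=
  Subgroup.normal_iInf_normal fun ρ => MonoidHom.normal_ker (ρ : G →* U)

end KernelIntersection

/-! ### Unipotent upper-triangular matrices -/

section Unitriangular

/-- `U_n(R)`: the group of unipotent upper-triangular `(n+1) × (n+1)` matrices over `R`. -/
def unitriangular (n : ℕ) (R : Type*) [CommRing R] : Subgroup (GL (Fin (n + 1)) R) where
  carrier := {M | (M : Matrix (Fin (n + 1)) (Fin (n + 1)) R).IsUpperTriangular ∧
    ∀ i, (M : Matrix (Fin (n + 1)) (Fin (n + 1)) R) i i = 1}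
  one_mem' := ⟨Matrix.blockTriangular_one, fun i => by simp⟩
  mul_mem' := by
    rintro a b ⟨ha, ha'⟩ ⟨hb, hb'⟩
    refine ⟨ha.mul hb, fun i => ?_⟩
    rw [Units.val_mul, Matrix.mul_apply, Finset.sum_eq_single i, ha', hb', one_mul]
    · intro k _ hk
      rcases lt_or_gt_of_ne hk with h | h
      · rw [ha h, zero_mul]
      · rw [hb h, mul_zero]
    · simp
  inv_mem' := by
    rintro a ⟨ha, ha'⟩
    have hinv : (a⁻¹ : GL (Fin (n + 1)) R).val.IsUpperTriangular := by
      have := a.invertible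
      rw [Matrix.coe_units_inv]
      exact Matrix.blockTriangular_inv_of_blockTriangular ha
    refine ⟨hinv, fun i => ?_⟩
    have h : (a.val * (a⁻¹ : GL (Fin (n + 1)) R).val) i i = 1 := by
      rw [← Units.val_mul, mul_inv_cancel]; simp
    rw [Matrix.mul_apply, Finset.sum_eq_single i, ha', one_mul] at h
    · exact h
    · intro k _ hk
      rcases lt_or_gt_of_ne hk with h | h
      · rw [ha h, zero_mul]
      · rw [hinv h, mul_zero]
    · simp

variable {n : ℕ} {R : Type*} [CommRing R]

/-- The underlying matrix of an element of `U_n(R)`. -/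
abbrev uMat (M : unitriangular n R) : Matrix (Fin (n + 1)) (Fin (n + 1)) R :=
  ((M : GL (Fin (n + 1)) R) : Matrix (Fin (n + 1)) (Fin (n + 1)) R)

theorem uMat_ext {M N : unitriangular n R} (h : uMat M = uMat N) : M = N :=
  Subtype.ext (Units.ext h)

theorem uMat_mul (M N : unitriangular n R) : uMat (M * N) = uMat M * uMat N := rfl

theorem uMat_diag (M : unitriangular n R) (i : Fin (n + 1)) : uMat M i i = 1 := M.2.2 i

theorem uMat_lower (M : unitriangular n R) {i j : Fin (n + 1)} (h : j < i) : uMat M i j = 0 :=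
  M.2.1 h

theorem single_mul_uMat (M : unitriangular n R) (r : R) :
    Matrix.single (0 : Fin (n + 1)) (Fin.last n) r * uMat M = Matrix.single (0 : Fin (n + 1)) (Fin.last n) r := by
  ext i j
  by_cases hi : i = 0
  · subst hi
    by_cases hj : j = Fin.last n
    · subst hj
      simp [uMat_diag]
    · simp [uMat_lower M (Fin.lt_last_iff_ne_last.2 hj), Ne.symm hj]
  · simp [hi, Ne.symm hi]

theorem uMat_mul_single (M : unitriangular n R) (r : R) :
    uMat M * Matrix.single (0 : Fin (n + 1)) (Fin.last n) r = Matrix.single (0 : Fin (n + 1)) (Fin.last n) r := by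
  ext i j
  by_cases hj : j = Fin.last n
  · subst hj
    by_cases hi : i = 0
    · subst hi
      simp [uMat_diag]
    · simp [uMat_lower M (Fin.pos_iff_ne_zero.2 hi), Ne.symm hi]
  · simp [hj, Ne.symm hj]

variable (n R)

/-- The central copy of `R⁺` in `U_n(R)`: the matrices `I + r E_{1,n+1}` with `r ∈ R`. -/
def unitriangularCentral : Subgroup (unitriangular n R) where
  carrier := {M | ∃ r : R, uMat M = 1 + Matrix.single (0 : Fin (n + 1)) (Fin.last n) r}
  one_mem' := ⟨0, by simp⟩
  mul_mem' := by
    rintro a b ⟨r, hr⟩ ⟨s, hs⟩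
    refine ⟨s + r, ?_⟩
    rw [uMat_mul, hr, Matrix.add_mul, Matrix.one_mul, single_mul_uMat, hs, Matrix.single_add, add_assoc]
  inv_mem' := by
    rintro a ⟨r, hr⟩
    refine ⟨-r, ?_⟩
    have h : uMat (a * a⁻¹) = 1 := by rw [mul_inv_cancel]; rfl
    rw [uMat_mul, hr, Matrix.add_mul, Matrix.one_mul, single_mul_uMat] at h
    rw [eq_sub_of_add_eq h, ← Matrix.single_neg, sub_eq_add_neg]

variable {n R}

theorem unitriangularCentral_comm {a : unitriangular n R} (ha : a ∈ unitriangularCentral n R)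
    (M : unitriangular n R) : a * M = M * a := by
  obtain ⟨r, hr⟩ := ha
  apply uMat_ext
  rw [uMat_mul, uMat_mul, hr, Matrix.add_mul, Matrix.mul_add, Matrix.one_mul,
    Matrix.mul_one, single_mul_uMat,
    uMat_mul_single]

instance unitriangularCentral_normal : (unitriangularCentral n R).Normal where
  conj_mem a ha g := by
    rwa [← unitriangularCentral_comm ha g, mul_inv_cancel_right]

/-- The entry `(1, n+1)` of `M - I`, for `M ∈ U_n(R)`; on the central subgroup it is the
isomorphism onto `R⁺` sending `I + r E_{1,n+1}` to `r`. -/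
def uCorner (M : unitriangular n R) : R := (uMat M - 1) 0 (Fin.last n)

theorem uCorner_mul {a : unitriangular n R} (ha : a ∈ unitriangularCentral n R)
    (M : unitriangular n R) : uCorner (a * M) = uCorner a + uCorner M := by
  obtain ⟨r, hr⟩ := ha
  simp only [uCorner]
  rw [uMat_mul, hr, Matrix.add_mul, Matrix.one_mul, single_mul_uMat]
  simp only [Matrix.sub_apply, Matrix.add_apply, Matrix.single_apply_same]
  ring

variable (n R)

/-- `Ū_n(R) = U_n(R) / R⁺`. -/
abbrev unitriangularBar : Type _ := unitriangular n R ⧸ unitriangularCentral n R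

variable {n R}

/-- The factor `s(x) s(y) s(xy)⁻¹` of a set-theoretic section `s` of `U_n(R) → Ū_n(R)`. -/
noncomputable def uFactor (x y : unitriangularBar n R) : unitriangular n R :=
  x.out * y.out * (x * y).out⁻¹

theorem uFactor_mem (x y : unitriangularBar n R) : uFactor x y ∈ unitriangularCentral n R := by
  rw [← QuotientGroup.eq_one_iff]
  simp [uFactor]

theorem uFactor_mul (x y z : unitriangularBar n R) :
    uFactor (x * y) z * uFactor x y = uFactor y z * uFactor x (y * z) := by
  have h1 : uFactor (x * y) z * uFactor x y = x.out * y.out * z.out * (x * y * z).out⁻¹ := by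
    rw [← unitriangularCentral_comm (uFactor_mem x y)]
    simp only [uFactor]
    group
  have h2 : uFactor y z * uFactor x (y * z) = x.out * y.out * z.out * (x * (y * z)).out⁻¹ := by
    have h : uFactor y z * uFactor x (y * z) =
        x.out * uFactor y z * (y * z).out * (x * (y * z)).out⁻¹ := by
      rw [← unitriangularCentral_comm (uFactor_mem y z) x.out]
      simp only [uFactor, mul_assoc]
    rw [h]
    simp only [uFactor]
    group
  rw [h1, h2, mul_assoc x y z]

variable (n R)

/-- The class in `H²(Ū_n(R), R⁺)` classifying the central extension
`0 → R⁺ → U_n(R) → Ū_n(R) → 1`, for a discrete ring `R`: the class of the cocycle `c` with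
`s(x) s(y) = c(x, y) s(xy)`, for a set-theoretic section `s`. -/
noncomputable def classifyingClass [TopologicalSpace R] [DiscreteTopology R] :
    contH2 (unitriangularBar n R) R :=
  contH2.mk R ⟨fun x => uCorner (uFactor x.1 x.2), by
    have : DiscreteTopology (unitriangularBar n R) :=
      QuotientGroup.discreteTopology (isOpen_discrete _)
    exact continuous_of_discreteTopology, fun x y z => by
    rw [← uCorner_mul (uFactor_mem _ _), ← uCorner_mul (uFactor_mem _ _), uFactor_mul]⟩

/-- The embedding of matrices as upper-left blocks, completed by `1` on the diagonal. -/
def blockEmb : Matrix (Fin (n + 1)) (Fin (n + 1)) R →*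
    Matrix (Fin (n + 1 + 1)) (Fin (n + 1 + 1)) R where
  toFun M := (Matrix.fromBlocks M 0 0 (1 : Matrix (Fin 1) (Fin 1) R)).submatrix
    finSumFinEquiv.symm finSumFinEquiv.symm
  map_one' := by simp
  map_mul' M N := by
    rw [Matrix.submatrix_mul_equiv, Matrix.fromBlocks_multiply]
    simp

theorem blockEmb_cast (M : Matrix (Fin (n + 1)) (Fin (n + 1)) R) (i j : Fin (n + 1)) :
    blockEmb n R M i.castSucc j.castSucc = M i j := by
  have h (i : Fin (n + 1)) : finSumFinEquiv.symm i.castSucc = Sum.inl i :=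
    finSumFinEquiv_symm_apply_castAdd (n := 1) i
  simp [blockEmb, h]

theorem blockEmb_last (M : Matrix (Fin (n + 1)) (Fin (n + 1)) R) (j : Fin (n + 1 + 1)) :
    blockEmb n R M (Fin.last (n + 1)) j = if j = Fin.last (n + 1) then 1 else 0 := by
  have h (i : Fin (n + 1)) : finSumFinEquiv.symm i.castSucc = Sum.inl i :=
    finSumFinEquiv_symm_apply_castAdd (n := 1) i
  induction j using Fin.lastCases with
  | last => simp [blockEmb]
  | cast j => simp [blockEmb, h, Fin.castSucc_ne_last]

theorem blockEmb_isUpperTriangular (M : unitriangular n R) :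
    (blockEmb n R (uMat M)).IsUpperTriangular := by
  intro i j hij
  replace hij : j < i := hij
  induction i using Fin.lastCases with
  | last => rw [blockEmb_last, if_neg hij.ne]
  | cast i =>
    induction j using Fin.lastCases with
    | last => exact absurd hij (Fin.le_last _).not_gt
    | cast j => rw [blockEmb_cast]; exact uMat_lower M (Fin.castSucc_lt_castSucc_iff.1 hij)

theorem blockEmb_diag (M : unitriangular n R) (i : Fin (n + 1 + 1)) :
    blockEmb n R (uMat M) i i = 1 := by
  induction i using Fin.lastCases with
  | last => rw [blockEmb_last, if_pos rfl]
  | cast i => rw [blockEmb_cast, uMat_diag]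

/-- The embedding of `U_n(R)` in `U_{n+1}(R)` as the upper-left block. -/
def unitriangularEmb : unitriangular n R →* unitriangular (n + 1) R :=
  ((Units.map (blockEmb n R)).comp (unitriangular n R).subtype).codRestrict
    (unitriangular (n + 1) R)
    fun M => ⟨blockEmb_isUpperTriangular n R M, blockEmb_diag n R M⟩

theorem kernelInter_unitriangular_succ_le [TopologicalSpace R] [IsTopologicalRing R]
    (G : Type*) [Group G] [TopologicalSpace G] :
    kernelInter (unitriangular (n + 1) R) G ≤ kernelInter (unitriangular n R) G := by
  have hc : Continuous (unitriangularEmb n R) := by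
    have h : Continuous fun M : Matrix (Fin (n + 1)) (Fin (n + 1)) R =>
        Matrix.fromBlocks M 0 0 (1 : Matrix (Fin 1) (Fin 1) R) :=
      Continuous.matrix_fromBlocks continuous_id continuous_const continuous_const
        continuous_const
    have h' : Continuous (blockEmb n R) := h.matrix_submatrix _ _
    exact ((h'.units_map _).comp continuous_subtype_val).subtype_mk _
  have hinj : Function.Injective (unitriangularEmb n R) := by
    intro M N h
    apply uMat_ext
    ext i j
    have h' := congrFun (congrFun (congrArg uMat h) i.castSucc) j.castSucc
    exact (blockEmb_cast n R (uMat M) i j).symm.trans (h'.trans (blockEmb_cast n R (uMat N) i j))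
  intro g hg
  rw [kernelInter, Subgroup.mem_iInf] at hg ⊢
  intro ρ
  have := hg ((⟨unitriangularEmb n R, hc⟩ : unitriangular n R →ₜ* unitriangular (n + 1) R).comp ρ)
  refine hinj ?_
  rw [map_one]
  exact this

theorem kernelInter_unitriangular_le_pred [TopologicalSpace R] [IsTopologicalRing R]
    (G : Type*) [Group G] [TopologicalSpace G] :
    kernelInter (unitriangular n R) G ≤ kernelInter (unitriangular (n - 1) R) G := by
  cases n with
  | zero => exact le_rfl
  | succ m => exact kernelInter_unitriangular_succ_le m R G

end Unitriangular

/-! ### The Zassenhaus setting -/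

section Zassenhaus

variable (p n : ℕ) (G : Type*) [Group G] [TopologicalSpace G]

/-- `T^{U_n}(G)`, where `U_n = U_n(ℤ/p)`. -/
abbrev TU : Subgroup G := kernelInter (unitriangular n (ZMod p)) G

/-- `H²(Ḡ)_{n-Massey,G}`, where `Ḡ = G / T^{U_{n-1}}(G)`: the subgroup of `H²(Ḡ) = H²(Ḡ, ℤ/p)`
generated by the elements of `n`-fold Massey products, that is, the pullbacks of the classifying
class of `0 → ℤ/p → U_n → Ū_n → 1` under continuous homomorphisms `Ḡ → Ū_n`, which become
trivial under the inflation to `H²(G)`. -/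
noncomputable def masseyPart : AddSubgroup (contH2 (G ⧸ TU p (n - 1) G) (ZMod p)) :=
  AddSubgroup.closure {x |
    (∃ ρ : (G ⧸ TU p (n - 1) G) →ₜ* unitriangularBar n (ZMod p),
      x = contH2.map (ZMod p) ρ (classifyingClass n (ZMod p))) ∧
    contH2.map (ZMod p) (quotProj (TU p (n - 1) G)) x = 0}

end Zassenhaus

/-! Write `N` for `TU p (n - 1) G` and `M` for `TU p n G`. A homomorphism `ρ : G → U_n` sends `N`
into the central corner, because its upper-left and lower-right blocks are homomorphisms to
`U_{n-1}`. The corner entry of `ρ` is thus a homomorphism `N → ℤ/p` trivial on `M`, and its negative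
transgresses to the pullback of the classifying class along the induced map `G/N → Ū_n`
(`isTransgression_cornerHom`). Conversely, a pullback that dies in `H²(G)` arises from such a `ρ`
(`exists_lift_of_map_classifyingClass_eq_zero`). So the Massey part consists of transgressions of
homomorphisms trivial on `M`, and these homomorphisms jointly cut out `M` in `N`.

As `n - 1 ≥ 1`, every homomorphism `G → ℤ/p` kills `N`, so transgression is injective. Inverting it
on the Massey part gives a pairing with `N/M`, nondegenerate on both sides, and compactness makes it
perfect (`isPerfectPairing_of_nondegenerate`).

For exactness, a class killed by inflation to `G/M` is the transgression of a homomorphism on `N/M`.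
Perfectness realizes that homomorphism by a Massey class, which must be the given one. -/

/-! ### Transgression and inflation at the level of cochains. -/

section CohomologyLemmas

variable {G : Type*} [Group G] [TopologicalSpace G]
variable {A : Type*} [AddCommGroup A] [TopologicalSpace A] [IsTopologicalAddGroup A]

theorem contH2.mk_eq_zero_iff (c : contCocycles₂ G A) :
    contH2.mk A c = 0 ↔
      ∃ y : G → A, Continuous y ∧ ∀ g h : G, c.1 (g, h) = y h - y (g * h) + y g :=
  (QuotientAddGroup.eq_zero_iff c).trans AddSubgroup.mem_addSubgroupOf

theorem contH2.mk_eq_mk_iff (c d : contCocycles₂ G A) :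
    contH2.mk A c = contH2.mk A d ↔
      ∃ y : G → A, Continuous y ∧
        ∀ g h : G, c.1 (g, h) - d.1 (g, h) = y h - y (g * h) + y g := by
  rw [← sub_eq_zero, ← map_sub, contH2.mk_eq_zero_iff]
  rfl

theorem contH2.map_mk {H : Type*} [Group H] [TopologicalSpace H] (φ : G →ₜ* H)
    (c : contCocycles₂ H A) :
    contH2.map A φ (contH2.mk A c) = contH2.mk A (contCocycles₂.map A φ c) := rfl

theorem contH2.mk_surjective (x : contH2 G A) : ∃ c, contH2.mk A c = x :=
  QuotientAddGroup.mk'_surjective _ x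

/-- The constant cocycle. -/
def contCocycles₂.const (a : A) : contCocycles₂ G A :=
  ⟨fun _ => a, continuous_const, fun _ _ _ => rfl⟩

variable {N : Subgroup G} [N.Normal]

/-- A cochain of `G` whose coboundary depends only on cosets modulo `N` restricts, up to a
constant, to a transgressive homomorphism. -/
theorem isTransgression_of_cochain {y : G → A} (hy : Continuous y) (c : contCocycles₂ (G ⧸ N) A)
    (hc : ∀ g h : G, c.1 ((g : G ⧸ N), (h : G ⧸ N)) = y h - y (g * h) + y g)
    (ψ : N →ₜ* Multiplicative A) (hψ : ∀ σ : N, (ψ σ).toAdd = y σ - y 1) :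
    IsTransgression N ψ (contH2.mk A c) := by
  have hone {σ : G} (hσ : σ ∈ N) : (σ : G ⧸ N) = ((1 : G) : G ⧸ N) :=
    (QuotientGroup.eq_one_iff σ).2 hσ
  -- The coboundary takes the same value at `(g, σ)` and at `(g, 1)`.
  have hr (g : G) (σ : G) (hσ : σ ∈ N) : y (g * σ) = y g + (y σ - y 1) := by
    have h1 := hc g σ
    rw [hone hσ, hc g 1, mul_one] at h1
    linear_combination (norm := abel) h1
  have hl (g : G) (σ : G) (hσ : σ ∈ N) : y (σ * g) = y g + (y σ - y 1) := by
    have h1 := hc σ g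
    rw [hone hσ, hc 1 g, one_mul] at h1
    linear_combination (norm := abel) h1
  -- Normalizing `y` to vanish at `1` changes `c` by a constant, which is the coboundary of a
  -- constant cochain.
  refine ⟨fun g σ => ?_, fun g => y g - y 1, c - contCocycles₂.const (y 1), ?_, ?_, ?_, ?_⟩
  · apply Multiplicative.toAdd.injective
    rw [hψ, hψ, MulAut.conjNormal_apply]
    have h1 := hl g (g * σ * g⁻¹) (Subgroup.Normal.conj_mem ‹_› _ σ.2 g)
    rw [inv_mul_cancel_right, hr g σ σ.2] at h1
    exact (add_left_cancel h1).symm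
  · exact hy.sub continuous_const
  · exact fun σ => (hψ σ).symm
  · intro g h
    change c.1 ((g : G ⧸ N), (h : G ⧸ N)) - y 1 = y h - y 1 - (y (g * h) - y 1) + (y g - y 1)
    rw [hc]
    abel
  · rw [contH2.mk_eq_mk_iff]
    refine ⟨fun _ => - y 1, continuous_const, fun g h => ?_⟩
    change c.1 (g, h) - y 1 - c.1 (g, h) = - y 1 - - y 1 + - y 1
    abel

theorem IsTransgression.one : IsTransgression N (1 : N →ₜ* Multiplicative A) 0 :=
  ⟨fun _ _ => rfl, 0, 0, continuous_const, fun _ => rfl, fun _ _ => by simp, map_zero _⟩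

theorem IsTransgression.mul {ψ ψ' : N →ₜ* Multiplicative A} {x x' : contH2 (G ⧸ N) A}
    (h : IsTransgression N ψ x) (h' : IsTransgression N ψ' x') :
    IsTransgression N (ψ * ψ') (x + x') := by
  obtain ⟨hi, y, c, hy, hψ, hc, rfl⟩ := h
  obtain ⟨hi', y', c', hy', hψ', hc', rfl⟩ := h'
  refine ⟨fun g σ => ?_, y + y', c + c', hy.add hy', fun σ => ?_, fun g h => ?_, map_add _ _ _⟩
  · change ψ _ * ψ' _ = ψ _ * ψ' _
    rw [hi, hi']
  · change _ = (ψ _ * ψ' _).toAdd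
    rw [toAdd_mul, ← hψ, ← hψ']
    rfl
  · change c.1 _ + c'.1 _ = _
    rw [hc, hc']
    simp only [Pi.add_apply]
    abel

theorem IsTransgression.inv {ψ : N →ₜ* Multiplicative A} {x : contH2 (G ⧸ N) A}
    (h : IsTransgression N ψ x) : IsTransgression N ψ⁻¹ (-x) := by
  obtain ⟨hi, y, c, hy, hψ, hc, rfl⟩ := h
  refine ⟨fun g σ => ?_, -y, -c, hy.neg, fun σ => ?_, fun g h => ?_, map_neg _ _⟩
  · change (ψ _)⁻¹ = (ψ _)⁻¹
    rw [hi]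
  · change _ = ((ψ _)⁻¹).toAdd
    rw [toAdd_inv, ← hψ]
    rfl
  · change - c.1 _ = _
    rw [hc]
    simp only [Pi.neg_apply]
    abel

/-- A cochain that vanishes on `N` and whose coboundary comes from `G/N` is constant on cosets, so
it descends and bounds the cocycle there. -/
theorem IsTransgression.eq_zero {x : contH2 (G ⧸ N) A}
    (h : IsTransgression N (1 : N →ₜ* Multiplicative A) x) : x = 0 := by
  obtain ⟨-, y, c, hy, hψ, hc, rfl⟩ := h
  have h1 {σ : G} (hσ : σ ∈ N) : y σ = 0 := hψ ⟨σ, hσ⟩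
  have hr (g : G) (σ : G) (hσ : σ ∈ N) : y (g * σ) = y g := by
    have h2 := hc g σ
    rw [show (σ : G ⧸ N) = ((1 : G) : G ⧸ N) from (QuotientGroup.eq_one_iff σ).2 hσ, hc g 1,
      mul_one, h1 hσ, h1 N.one_mem] at h2
    linear_combination (norm := abel) h2
  rw [contH2.mk_eq_zero_iff]
  refine ⟨Quotient.lift y fun a b hab => ?_, hy.quotient_lift _, fun g h => ?_⟩
  · rw [← hr a _ (QuotientGroup.leftRel_apply.1 hab), mul_inv_cancel_left]
  · induction g using QuotientGroup.induction_on
    induction h using QuotientGroup.induction_on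
    exact hc _ _

theorem IsTransgression.unique_right {ψ : N →ₜ* Multiplicative A} {x x' : contH2 (G ⧸ N) A}
    (h : IsTransgression N ψ x) (h' : IsTransgression N ψ x') : x = x' := by
  have := h.mul h'.inv
  rw [mul_inv_cancel] at this
  exact add_neg_eq_zero.1 this.eq_zero

/-- Transgression is injective when every continuous homomorphism `G → A` is trivial on `N`. -/
theorem IsTransgression.eq_one
    (hN : ∀ χ : G →ₜ* Multiplicative A, ∀ σ ∈ N, χ σ = 1)
    {ψ : N →ₜ* Multiplicative A} (h : IsTransgression N ψ 0) : ψ = 1 := by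
  obtain ⟨-, y, c, hy, hψ, hc, h0⟩ := h
  obtain ⟨u, hu, hcu⟩ := (contH2.mk_eq_zero_iff c).1 h0
  -- Both `y` and the inflation of `u` have coboundary `c`, so their difference is a homomorphism,
  -- which must kill `N`.
  let χ : G →ₜ* Multiplicative A :=
    { MonoidHom.mk' (fun g => Multiplicative.ofAdd (y g - u g)) fun g h => by
        rw [← ofAdd_add]
        congr 1
        have h1 := hcu g h
        rw [hc, ← QuotientGroup.mk_mul] at h1
        linear_combination (norm := abel) -h1 with
      continuous_toFun :=
        continuous_ofAdd.comp (hy.sub (hu.comp continuous_quotient_mk')) }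
  have h1 (σ : N) : (ψ σ).toAdd = u 1 := by
    have h2 : y σ - u (σ : G) = 0 := hN χ σ σ.2
    rw [(QuotientGroup.eq_one_iff _).2 σ.2] at h2
    rw [← hψ, sub_eq_zero.1 h2]
  ext σ
  apply Multiplicative.toAdd.injective
  rw [h1, ← h1 1, map_one]
  rfl

theorem IsTransgression.unique_left
    (hN : ∀ χ : G →ₜ* Multiplicative A, ∀ σ ∈ N, χ σ = 1)
    {ψ ψ' : N →ₜ* Multiplicative A} {x : contH2 (G ⧸ N) A}
    (h : IsTransgression N ψ x) (h' : IsTransgression N ψ' x) : ψ = ψ' := by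
  have := h.mul h'.inv
  rw [add_neg_cancel] at this
  exact mul_inv_eq_one.1 (this.eq_one hN)

variable {M : Subgroup G} [M.Normal]

/-- The transgression of a homomorphism trivial on `M` is killed by the inflation to `G/M`. -/
theorem IsTransgression.map_quotMap_eq_zero (hM : M ≤ N) {ψ : N →ₜ* Multiplicative A}
    {x : contH2 (G ⧸ N) A} (h : IsTransgression N ψ x) (hψM : ∀ σ : N, (σ : G) ∈ M → ψ σ = 1) :
    contH2.map A (quotMap hM) x = 0 := by
  obtain ⟨-, y, c, hy, hψ, hc, rfl⟩ := h
  have h1 {σ : G} (hσ : σ ∈ M) : y σ = 0 := by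
    rw [hψ ⟨σ, hM hσ⟩, hψM _ hσ]
    rfl
  have hr (g : G) (σ : G) (hσ : σ ∈ M) : y (g * σ) = y g := by
    have h2 := hc g σ
    rw [show (σ : G ⧸ N) = ((1 : G) : G ⧸ N) from (QuotientGroup.eq_one_iff σ).2 (hM hσ), hc g 1,
      mul_one, h1 hσ, h1 M.one_mem] at h2
    linear_combination (norm := abel) h2
  rw [contH2.map_mk, contH2.mk_eq_zero_iff]
  refine ⟨Quotient.lift y fun a b hab => ?_, hy.quotient_lift _, fun g h => ?_⟩
  · rw [← hr a _ (QuotientGroup.leftRel_apply.1 hab), mul_inv_cancel_left]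
  · induction g using QuotientGroup.induction_on
    induction h using QuotientGroup.induction_on
    exact hc _ _

/-- A class killed by the inflation to `G/M` is the transgression of a homomorphism trivial
on `M`. -/
theorem exists_isTransgression_of_map_quotMap_eq_zero (hM : M ≤ N) {x : contH2 (G ⧸ N) A}
    (hx : contH2.map A (quotMap hM) x = 0) :
    ∃ ψ : N →ₜ* Multiplicative A, IsTransgression N ψ x ∧ ∀ σ : N, (σ : G) ∈ M → ψ σ = 1 := by
  obtain ⟨c, rfl⟩ := contH2.mk_surjective x
  rw [contH2.map_mk, contH2.mk_eq_zero_iff] at hx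
  obtain ⟨u, hu, hcu⟩ := hx
  have hc (g h : G) : c.1 ((g : G ⧸ N), (h : G ⧸ N)) =
      u (h : G) - u ((g * h : G) : G ⧸ M) + u (g : G) := hcu g h
  have hone {σ : G} (hσ : σ ∈ N) : (σ : G ⧸ N) = ((1 : G) : G ⧸ N) :=
    (QuotientGroup.eq_one_iff σ).2 hσ
  have hcont : Continuous fun g : G => u (g : G ⧸ M) := hu.comp continuous_quotient_mk'
  -- On `N` the coboundary of `u` is the constant `c(1, 1) = u 1`, so `u - u 1` is additive there.
  let ψ : N →ₜ* Multiplicative A :=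
    { MonoidHom.mk' (fun σ : N => Multiplicative.ofAdd (u (σ : G) - u (1 : G))) fun σ τ => by
        rw [← ofAdd_add]
        congr 1
        have h1 := hc σ τ
        rw [hone σ.2, hone τ.2, hc 1 1, mul_one] at h1
        rw [Subgroup.coe_mul]
        linear_combination (norm := abel) h1 with
      continuous_toFun :=
        continuous_ofAdd.comp ((hcont.comp continuous_subtype_val).sub continuous_const) }
  refine ⟨ψ, isTransgression_of_cochain hcont c hc ψ fun σ => rfl, fun σ hσ => ?_⟩
  change u (σ : G) - u (1 : G) = 0
  rw [(QuotientGroup.eq_one_iff _).2 hσ]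
  exact sub_self _

end CohomologyLemmas

/-! ### Duality between compact groups and discrete groups over `ℤ/p`. -/

section Duality

variable {p : ℕ} [Fact p.Prime]

/-- A homomorphism to `ℤ/p` which vanishes where finitely many others vanish lies in their span. -/
theorem mem_span_of_forall_eq_zero {A : Type*} [AddGroup A] (s : Finset (A →+ ZMod p))
    (f : A →+ ZMod p) (h : ∀ a, (∀ g ∈ s, g a = 0) → f a = 0) :
    f ∈ Submodule.span (ZMod p) (s : Set (A →+ ZMod p)) := by
  classical
  induction s using Finset.induction_on generalizing f with
  | empty =>
    have : f = 0 := AddMonoidHom.ext fun a => h a (by simp)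
    simp [this]
  | insert g s _ ih =>
    rw [Finset.coe_insert]
    by_cases hg : ∀ a, (∀ k ∈ s, k a = 0) → g a = 0
    · refine Submodule.span_mono (Set.subset_insert _ _) (ih f fun a ha => h a ?_)
      simpa [hg a ha] using ha
    · push Not at hg
      obtain ⟨b, hb, hgb⟩ := hg
      -- If `s` kills `a`, subtracting the multiple of `b` that cancels `g a` gives an element
      -- killed by `g` as well, hence by `f`.
      have key : f - (f b / g b) • g ∈ Submodule.span (ZMod p) (s : Set (A →+ ZMod p)) := by
        refine ih _ fun a ha => ?_
        have h1 : f (a - (g a / g b).val • b) = 0 := by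
          refine h _ fun k hk => ?_
          rw [map_sub, map_nsmul, nsmul_eq_mul, ZMod.natCast_val, ZMod.cast_id]
          rcases Finset.mem_insert.1 hk with rfl | hk
          · field_simp
            simp
          · rw [ha k hk, hb k hk]
            simp
        rw [map_sub, map_nsmul, nsmul_eq_mul, ZMod.natCast_val, ZMod.cast_id] at h1
        change f a - (f b / g b) * g a = 0
        rw [← h1]
        ring
      have := Submodule.add_mem _ (Submodule.span_mono (Set.subset_insert g _) key)
        (Submodule.smul_mem _ (f b / g b) (Submodule.subset_span (Set.mem_insert g s)))
      rwa [sub_add_cancel] at this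

/-- If the values of `f` on `s` were not attained, a linear functional on `(ℤ/p)^s` would separate
them from the image of `A`. Its coefficients give a combination of elements of `s` orthogonal to all
of `A`, hence zero, yet not killed by `f`. -/
theorem exists_forall_eq_of_injective {A B : Type*} [AddGroup A] [AddCommGroup B]
    (β : A →+ B →+ ZMod p) (hβ : ∀ b, (∀ a, β a b = 0) → b = 0) (f : B →+ ZMod p)
    (s : Finset B) : ∃ a, ∀ b ∈ s, β a b = f b := by
  classical
  let V : AddSubgroup (s → ZMod p) := AddMonoidHom.range
    (AddMonoidHom.mk' (fun a (b : s) => β a b) fun a a' => by ext; simp)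
  by_contra hcon
  have hf : (fun b : s => f b) ∉ AddSubgroup.toZModSubmodule p V := by
    rintro ⟨a, ha⟩
    exact hcon ⟨a, fun b hb => congrFun ha ⟨b, hb⟩⟩
  obtain ⟨φ, hφ, hV⟩ := Submodule.exists_le_ker_of_notMem hf
  have hφ' (v : s → ZMod p) : φ v = ∑ b, (φ (Pi.single b 1)).val • v b := by
    conv_lhs => rw [← Finset.univ_sum_single v, map_sum]
    refine Finset.sum_congr rfl fun b _ => ?_
    rw [nsmul_eq_mul, ZMod.natCast_val, ZMod.cast_id, mul_comm, ← smul_eq_mul, ← map_smul]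
    congr 1
    rw [← Pi.single_smul, smul_eq_mul, mul_one]
  have h0 : ∑ b : s, (φ (Pi.single b 1)).val • (b : B) = 0 := by
    refine hβ _ fun a => ?_
    rw [map_sum]
    have := hV (show (fun b : s => β a b) ∈ AddSubgroup.toZModSubmodule p V from ⟨a, rfl⟩)
    rw [LinearMap.mem_ker, hφ'] at this
    simpa using this
  apply hφ
  rw [hφ']
  have := congrArg f h0
  rw [map_sum, map_zero] at this
  simpa using this

/-- A nondegenerate pairing of a compact group and a discrete group with values in `ℤ/p` is
perfect. -/
theorem isPerfectPairing_of_nondegenerate {A B : Type*} [AddGroup A] [TopologicalSpace A]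
    [CompactSpace A] [AddCommGroup B] (β : A →+ B →+ ZMod p)
    (hc : ∀ b, Continuous fun a => β a b) (hl : ∀ a, (∀ b, β a b = 0) → a = 0)
    (hr : ∀ b, (∀ a, β a b = 0) → b = 0) : IsPerfectPairing β where
  continuous_left := hc
  bijective_left := by
    refine ⟨(injective_iff_map_eq_zero β).2 fun a ha => hl a fun b => by rw [ha]; rfl,
      fun f => ?_⟩
    have hclosed (b : B) : IsClosed {a | β a b = f b} := isClosed_singleton.preimage (hc b)
    -- Each finite set of conditions on `a` is solvable, so compactness solves all of them at once.
    obtain ⟨a, ha⟩ := CompactSpace.iInter_nonempty hclosed fun s => by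
      obtain ⟨a, ha⟩ := exists_forall_eq_of_injective β hr f s
      exact ⟨a, by simpa using ha⟩
    exact ⟨a, AddMonoidHom.ext fun b => Set.mem_iInter.1 ha b⟩
  bijective_right := by
    classical
    refine ⟨fun b b' h => ?_, fun f => ?_⟩
    · refine sub_eq_zero.1 (hr _ fun a => ?_)
      rw [map_sub, sub_eq_zero]
      exact DFunLike.congr_fun h a
    · have hopen (b : B) : IsOpen {a | β a b ≠ 0} :=
        (isOpen_discrete {x : ZMod p | x ≠ 0}).preimage (hc b)
      have hK : IsCompact {a | f a ≠ 0} :=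
        ((isClosed_discrete {x : ZMod p | x ≠ 0}).preimage (map_continuous f)).isCompact
      -- Outside finitely many of these open sets `f` vanishes, so `f` lies in the span of finitely
      -- many `β.flip b`.
      obtain ⟨s, hs⟩ := hK.elim_finite_subcover _ hopen fun a ha => by
        rw [Set.mem_iUnion]
        by_contra! h
        refine ha ?_
        rw [hl a fun b => by simpa using h b, map_zero]
      have hmem := mem_span_of_forall_eq_zero (s.image β.flip) (f : A →+ ZMod p) fun a ha => by
        by_contra hfa
        obtain ⟨b, hb, hab⟩ := Set.mem_iUnion₂.1 (hs hfa)
        exact hab (ha _ (Finset.mem_image_of_mem _ hb))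
      -- Additive subgroups are `ℤ/p`-subspaces, so the span stays inside the range of `β.flip`.
      have hle : Submodule.span (ZMod p) ((s.image β.flip : Finset _) : Set (A →+ ZMod p)) ≤
          AddSubgroup.toZModSubmodule p β.flip.range := by
        rw [Submodule.span_le]
        intro g hg
        obtain ⟨b, -, rfl⟩ := Finset.mem_image.1 (Finset.mem_coe.1 hg)
        exact ⟨b, rfl⟩
      obtain ⟨b, hb⟩ := hle hmem
      exact ⟨b, ContinuousAddMonoidHom.ext fun a => DFunLike.congr_fun hb a⟩

end Duality

/-! ### Blocks and corners of unitriangular matrices, and the lifting problem. -/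

section UnitriangularLemmas

variable {n : ℕ} {R : Type*} [CommRing R]

/-- The monoid homomorphisms to matrices with unitriangular values, as homomorphisms to `U_n(R)`. -/
def toUnitriangular {H : Type*} [Group H] (φ : H →* Matrix (Fin (n + 1)) (Fin (n + 1)) R)
    (hlow : ∀ h i j, j < i → φ h i j = 0) (hdiag : ∀ h i, φ h i i = 1) :
    H →* unitriangular n R :=
  φ.toHomUnits.codRestrict (unitriangular n R) fun h => ⟨fun i j hij => hlow h i j hij, hdiag h⟩

/-- The upper-left block. -/
def unitriangularUpperLeft : unitriangular (n + 1) R →* unitriangular n R :=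
  toUnitriangular
    { toFun M := (uMat M).submatrix Fin.castSucc Fin.castSucc
      map_one' := Matrix.submatrix_one _ (Fin.castSucc_injective _)
      map_mul' M N := by
        ext i j
        rw [uMat_mul, Matrix.submatrix_apply, Matrix.mul_apply, Fin.sum_univ_castSucc,
          uMat_lower N (Fin.castSucc_lt_last j), mul_zero, add_zero]
        rfl }
    (fun M i j h => uMat_lower M (Fin.castSucc_lt_castSucc_iff.2 h))
    (fun M i => uMat_diag M i.castSucc)

/-- The lower-right block. -/
def unitriangularLowerRight : unitriangular (n + 1) R →* unitriangular n R :=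
  toUnitriangular
    { toFun M := (uMat M).submatrix Fin.succ Fin.succ
      map_one' := Matrix.submatrix_one _ (Fin.succ_injective _)
      map_mul' M N := by
        ext i j
        rw [uMat_mul, Matrix.submatrix_apply, Matrix.mul_apply, Fin.sum_univ_succ,
          uMat_lower M (Fin.succ_pos i), zero_mul, zero_add]
        rfl }
    (fun M i j h => uMat_lower M (Fin.succ_lt_succ_iff.2 h))
    (fun M i => uMat_diag M i.succ)

/-- The corner is the only entry on or above the diagonal lying in neither block. -/
theorem mem_unitriangularCentral_of_blocks {M : unitriangular (n + 1) R}
    (h1 : unitriangularUpperLeft M = 1) (h2 : unitriangularLowerRight M = 1) :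
    M ∈ unitriangularCentral (n + 1) R := by
  have h1' (i j : Fin (n + 1)) : uMat M i.castSucc j.castSucc = (1 : Matrix _ _ R) i j :=
    congrFun (congrFun (congrArg uMat h1) i) j
  have h2' (i j : Fin (n + 1)) : uMat M i.succ j.succ = (1 : Matrix _ _ R) i j :=
    congrFun (congrFun (congrArg uMat h2) i) j
  refine ⟨uMat M 0 (Fin.last _), ?_⟩
  ext i j
  rw [Matrix.add_apply]
  rcases lt_trichotomy j i with hij | rfl | hij
  · rw [uMat_lower M hij, Matrix.one_apply_ne hij.ne', Matrix.single_apply_of_ne, add_zero]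
    rintro ⟨rfl, rfl⟩
    exact (Fin.zero_le _).not_gt hij
  · rw [uMat_diag, Matrix.one_apply_eq, Matrix.single_apply_of_ne, add_zero]
    rintro ⟨rfl, h⟩
    exact (Fin.last_pos (n := n)).ne h.symm
  · by_cases hj : j = Fin.last _
    · by_cases hi : i = 0
      · subst hi hj
        rw [Matrix.single_apply_same, Matrix.one_apply_ne hij.ne, zero_add]
      · obtain ⟨i, rfl⟩ := Fin.exists_succ_eq.2 hi
        obtain ⟨j, rfl⟩ := Fin.exists_succ_eq.2 (Fin.ne_zero_of_lt hij)
        rw [h2', Matrix.one_apply_ne (Fin.succ_lt_succ_iff.1 hij).ne, Matrix.one_apply_ne hij.ne,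
          Matrix.single_apply_of_ne, add_zero]
        exact fun h => hi h.1.symm
    · obtain ⟨i, rfl⟩ := Fin.exists_castSucc_eq.2 (Fin.ne_last_of_lt hij)
      obtain ⟨j, rfl⟩ := Fin.exists_castSucc_eq.2 hj
      rw [h1', Matrix.one_apply_ne (Fin.castSucc_lt_castSucc_iff.1 hij).ne,
        Matrix.one_apply_ne hij.ne, Matrix.single_apply_of_ne, add_zero]
      exact fun h => hj h.2.symm

variable (n R) in
/-- The embedding `r ↦ I + r E_{1,n+2}` of `R⁺` in `U_{n+1}(R)`. -/
def unitriangularCentralHom : Multiplicative R →* unitriangular (n + 1) R :=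
  toUnitriangular
    { toFun r := 1 + Matrix.single 0 (Fin.last (n + 1)) r.toAdd
      map_one' := by simp
      map_mul' r s := by
        rw [add_mul, mul_add, mul_add, one_mul, one_mul, mul_one, Matrix.single_mul_single_of_ne, toAdd_mul,
          Matrix.single_add]
        · abel
        · exact (Fin.last_pos (n := n)).ne' }
    (fun r i j h => by
      change (1 : Matrix _ _ R) i j + _ = _
      rw [Matrix.one_apply_ne h.ne', Matrix.single_apply_of_ne, add_zero]
      rintro ⟨rfl, rfl⟩
      exact (Fin.zero_le _).not_gt h)
    (fun r i => by
      change (1 : Matrix _ _ R) i i + _ = _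
      rw [Matrix.one_apply_eq, Matrix.single_apply_of_ne, add_zero]
      rintro ⟨rfl, h⟩
      exact (Fin.last_pos (n := n)).ne h.symm)

theorem uMat_unitriangularCentralHom (r : Multiplicative R) :
    uMat (unitriangularCentralHom n R r) = 1 + Matrix.single 0 (Fin.last (n + 1)) r.toAdd := rfl

theorem unitriangularCentralHom_mem (r : Multiplicative R) :
    unitriangularCentralHom n R r ∈ unitriangularCentral (n + 1) R := ⟨_, rfl⟩

theorem uCorner_unitriangularCentralHom (r : Multiplicative R) :
    uCorner (unitriangularCentralHom n R r) = r.toAdd := by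
  rw [uCorner, uMat_unitriangularCentralHom, add_sub_cancel_left, Matrix.single_apply_same]

theorem unitriangularCentralHom_uCorner {a : unitriangular (n + 1) R}
    (ha : a ∈ unitriangularCentral (n + 1) R) :
    unitriangularCentralHom n R (Multiplicative.ofAdd (uCorner a)) = a := by
  obtain ⟨r, hr⟩ := ha
  apply uMat_ext
  rw [uMat_unitriangularCentralHom, hr, uCorner, hr, add_sub_cancel_left,
    Matrix.single_apply_same, toAdd_ofAdd]

theorem unitriangularCentralHom_injective :
    Function.Injective (unitriangularCentralHom n R) := fun r s h => by
  have := congrArg uCorner h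
  rwa [uCorner_unitriangularCentralHom, uCorner_unitriangularCentralHom] at this

theorem uCorner_one : uCorner (1 : unitriangular n R) = 0 := by
  rw [uCorner, show uMat (1 : unitriangular n R) = 1 from rfl, sub_self]
  rfl

variable [TopologicalSpace R] [DiscreteTopology R]

instance unitriangular_discreteTopology : DiscreteTopology (unitriangular n R) := by
  have : DiscreteTopology (Matrix (Fin (n + 1)) (Fin (n + 1)) R) :=
    inferInstanceAs (DiscreteTopology (Fin (n + 1) → Fin (n + 1) → R))
  have : DiscreteTopology (GL (Fin (n + 1)) R) := inferInstance
  infer_instance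

instance unitriangularBar_discreteTopology : DiscreteTopology (unitriangularBar n R) :=
  QuotientGroup.discreteTopology (isOpen_discrete _)

variable {G : Type*} [Group G] [TopologicalSpace G]

theorem eq_one_of_mem_kernelInter {U : Type*} [Group U] [TopologicalSpace U] {σ : G}
    (h : σ ∈ kernelInter U G) (ρ : G →ₜ* U) : ρ σ = 1 :=
  (Subgroup.mem_iInf.1 h ρ :)

theorem mem_central_of_mem_kernelInter {σ : G} (h : σ ∈ kernelInter (unitriangular n R) G)
    (ρ : G →ₜ* unitriangular (n + 1) R) : ρ σ ∈ unitriangularCentral (n + 1) R :=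
  mem_unitriangularCentral_of_blocks
    (eq_one_of_mem_kernelInter h
      ((⟨unitriangularUpperLeft, continuous_of_discreteTopology⟩ :
        unitriangular (n + 1) R →ₜ* unitriangular n R).comp ρ))
    (eq_one_of_mem_kernelInter h
      ((⟨unitriangularLowerRight, continuous_of_discreteTopology⟩ :
        unitriangular (n + 1) R →ₜ* unitriangular n R).comp ρ))

/-- `R⁺` embeds in `U_{n+1}(R)` as the corner. This supplies the hypothesis under which
transgression is injective. -/
theorem hom_eq_one_of_mem_kernelInter {σ : G}
    (h : σ ∈ kernelInter (unitriangular (n + 1) R) G) (χ : G →ₜ* Multiplicative R) : χ σ = 1 :=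
  unitriangularCentralHom_injective (n := n) <| by
    rw [map_one]
    exact eq_one_of_mem_kernelInter h
      ((⟨unitriangularCentralHom n R, continuous_of_discreteTopology⟩ :
        Multiplicative R →ₜ* unitriangular (n + 1) R).comp χ)

/-- The corner entry of `ρ : G → U_{n+1}(R)`, as a homomorphism on `T^{U_n}(G)`. -/
def cornerHom (ρ : G →ₜ* unitriangular (n + 1) R) :
    kernelInter (unitriangular n R) G →ₜ* Multiplicative R where
  toMonoidHom := MonoidHom.mk' (fun σ => Multiplicative.ofAdd (uCorner (ρ σ))) fun σ τ => by
    rw [Subgroup.coe_mul, map_mul, uCorner_mul (mem_central_of_mem_kernelInter σ.2 ρ), ofAdd_add]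
  continuous_toFun := (continuous_of_discreteTopology
    (f := fun M : unitriangular (n + 1) R => Multiplicative.ofAdd (uCorner M))).comp
      ((map_continuous ρ).comp continuous_subtype_val)

theorem cornerHom_apply (ρ : G →ₜ* unitriangular (n + 1) R)
    (σ : kernelInter (unitriangular n R) G) : (cornerHom ρ σ).toAdd = uCorner (ρ σ) := rfl

theorem eq_one_of_cornerHom_eq_one {ρ : G →ₜ* unitriangular (n + 1) R}
    {σ : kernelInter (unitriangular n R) G} (h : cornerHom ρ σ = 1) : ρ σ = 1 := by
  rw [← unitriangularCentralHom_uCorner (mem_central_of_mem_kernelInter σ.2 ρ)]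
  exact (congrArg (unitriangularCentralHom n R) h).trans (map_one _)

variable [IsTopologicalRing R]

/-- If `ρ` lifts `ρ' : G/T^{U_n}(G) → Ū_{n+1}`, the pullback of the classifying class along `ρ'`
is the negative of the transgression of the corner entry of `ρ`. -/
theorem isTransgression_cornerHom (ρ : G →ₜ* unitriangular (n + 1) R)
    (ρ' : (G ⧸ kernelInter (unitriangular n R) G) →ₜ* unitriangularBar (n + 1) R)
    (h : ∀ g : G, ρ' g = (ρ g : unitriangularBar (n + 1) R)) :
    IsTransgression (kernelInter (unitriangular n R) G) (cornerHom ρ)⁻¹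
      (contH2.map R ρ' (classifyingClass (n + 1) R)) := by
  -- The central discrepancy between `M` and the chosen lift of its class. By `hzmul`, the factor
  -- set is the coboundary of minus its corner, which explains the sign in the statement.
  let z (M : unitriangular (n + 1) R) : unitriangular (n + 1) R :=
    M * (M : unitriangularBar (n + 1) R).out⁻¹
  have hz (M) : z M ∈ unitriangularCentral (n + 1) R := by
    rw [← QuotientGroup.eq_one_iff]
    simp [z]
  have hzmul (M M' : unitriangular (n + 1) R) :
      z M * (z M' * uFactor (M : unitriangularBar (n + 1) R) M') = z (M * M') := by
    rw [← mul_assoc, unitriangularCentral_comm (hz M), mul_assoc]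
    simp only [uFactor]
    rw [← mul_assoc (z M), ← mul_assoc (z M)]
    have : z M * (M : unitriangularBar (n + 1) R).out = M := by simp [z]
    rw [this, ← mul_assoc, ← mul_assoc, unitriangularCentral_comm (hz M') M, mul_assoc M]
    have : z M' * (M' : unitriangularBar (n + 1) R).out = M' := by simp [z]
    rw [this, ← QuotientGroup.mk_mul]
  rw [classifyingClass, contH2.map_mk]
  refine isTransgression_of_cochain (y := fun g => - uCorner (z (ρ g)))
    ((continuous_of_discreteTopology (f := fun M => - uCorner (z M))).comp (map_continuous ρ)) _
    (fun g g' => ?_) _ fun σ => ?_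
  · change uCorner (uFactor (ρ' (g : G ⧸ _)) (ρ' (g' : G ⧸ _))) = _
    rw [h, h, map_mul, ← hzmul, uCorner_mul (hz _), uCorner_mul (hz _)]
    ring
  · change - uCorner (ρ σ) = _
    -- The section need not send `1` to `1`, so `z 1` remains as a correction.
    have h1 : uCorner (ρ σ) + uCorner (z 1) = uCorner (z (ρ σ)) := by
      have hσ := mem_central_of_mem_kernelInter σ.2 ρ
      rw [← uCorner_mul hσ]
      simp only [z, (QuotientGroup.eq_one_iff (ρ σ)).2 hσ, one_mul, QuotientGroup.mk_one]
    rw [map_one, ← h1]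
    ring

/-- A homomorphism `G → Ū_{n+1}` which kills the classifying class lifts to `U_{n+1}`. -/
theorem exists_lift_of_map_classifyingClass_eq_zero (ρ' : G →ₜ* unitriangularBar (n + 1) R)
    (h : contH2.map R ρ' (classifyingClass (n + 1) R) = 0) :
    ∃ ρ : G →ₜ* unitriangular (n + 1) R, ∀ g, ρ' g = (ρ g : unitriangularBar (n + 1) R) := by
  rw [classifyingClass, contH2.map_mk, contH2.mk_eq_zero_iff] at h
  obtain ⟨y, hy, hc⟩ := h
  replace hc (g g' : G) : uCorner (uFactor (ρ' g) (ρ' g')) = y g' - y (g * g') + y g := hc g g'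
  let χ (r : R) := unitriangularCentralHom n R (Multiplicative.ofAdd r)
  have hχ (r) : χ r ∈ unitriangularCentral (n + 1) R := unitriangularCentralHom_mem _
  have hχadd (r s) : χ (r + s) = χ r * χ s := by simp only [χ, ofAdd_add, map_mul]
  -- Twisting the section along `ρ'` by the central element with corner `-y` cancels the factor set.
  have hmul (g g' : G) : χ (- y (g * g')) * (ρ' (g * g')).out =
      χ (- y g) * (ρ' g).out * (χ (- y g') * (ρ' g').out) := by
    have h1 : χ (y g' - y (g * g') + y g) = uFactor (ρ' g) (ρ' g') := by
      rw [← hc]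
      exact unitriangularCentralHom_uCorner (uFactor_mem _ _)
    have h2 : - y (g * g') = - y g + (- y g' + (y g' - y (g * g') + y g)) := by ring
    have h3 : uFactor (ρ' g) (ρ' g') * (ρ' (g * g')).out = (ρ' g).out * (ρ' g').out := by
      rw [uFactor, map_mul, inv_mul_cancel_right]
    have h4 : (ρ' g).out * χ (- y g') = χ (- y g') * (ρ' g).out :=
      (unitriangularCentral_comm (hχ _) _).symm
    rw [h2, hχadd, hχadd, h1, mul_assoc, mul_assoc, h3, mul_assoc,
      ← mul_assoc (ρ' g).out (χ (- y g')), h4, mul_assoc]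
  obtain ⟨φ, hφ⟩ : ∃ φ : G →* unitriangular (n + 1) R, ∀ g, φ g = χ (- y g) * (ρ' g).out :=
    ⟨MonoidHom.mk' _ hmul, fun _ => rfl⟩
  have hcont : Continuous φ := by
    have h1 : Continuous fun q : R × unitriangularBar (n + 1) R => χ (- q.1) * q.2.out :=
      continuous_of_discreteTopology
    exact (h1.comp (hy.prodMk (map_continuous ρ'))).congr fun g => (hφ g).symm
  refine ⟨⟨φ, hcont⟩, fun g => ?_⟩
  change _ = (φ g : unitriangularBar (n + 1) R)
  rw [hφ, QuotientGroup.mk_mul, (QuotientGroup.eq_one_iff _).2 (hχ _), one_mul,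
    QuotientGroup.out_eq']

/-- The homomorphism `G/T^{U_n}(G) → Ū_{n+1}(R)` induced by `ρ : G → U_{n+1}(R)`. -/
def unitriangularBarHom (ρ : G →ₜ* unitriangular (n + 1) R) :
    (G ⧸ kernelInter (unitriangular n R) G) →ₜ* unitriangularBar (n + 1) R where
  toMonoidHom := QuotientGroup.lift _ ((QuotientGroup.mk' _).comp (ρ : G →* _)) fun _ hσ =>
    (QuotientGroup.eq_one_iff _).2 (mem_central_of_mem_kernelInter hσ ρ)
  continuous_toFun := Continuous.quotient_lift
    ((continuous_of_discreteTopology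
      (f := fun M : unitriangular (n + 1) R => (M : unitriangularBar (n + 1) R))).comp
        (map_continuous ρ)) _

end UnitriangularLemmas

/-! ### The transgression pairing and the Massey part. -/

section Pairing

variable {p : ℕ} [Fact p.Prime] {G : Type*} [Group G] [TopologicalSpace G]

/-- The homomorphism induced on a quotient by a continuous homomorphism. -/
def ContinuousMonoidHom.quotientLift {H K : Type*} [Group H] [TopologicalSpace H] [Group K]
    [TopologicalSpace K] {L : Subgroup H} [L.Normal] (ψ : H →ₜ* K) (h : ∀ σ ∈ L, ψ σ = 1) :
    H ⧸ L →ₜ* K where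
  toMonoidHom := QuotientGroup.lift L (ψ : H →* K) h
  continuous_toFun := (map_continuous ψ).quotient_lift _

/-- A group of classes consisting of transgressions of homomorphisms trivial on `M`, and large
enough to cut out `M` in `N`, is dual to `N/M` and equal to the kernel of the inflation
to `G/M`. -/
theorem exists_perfect_transgression_pairing [CompactSpace G] {M N : Subgroup G} [M.Normal]
    [N.Normal] (hMN : M ≤ N) (hclosed : IsClosed (N : Set G))
    (hN : ∀ χ : G →ₜ* Multiplicative (ZMod p), ∀ σ ∈ N, χ σ = 1)
    (B : AddSubgroup (contH2 (G ⧸ N) (ZMod p)))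
    (hB : ∀ x ∈ B, ∃ ψ : N →ₜ* Multiplicative (ZMod p),
      IsTransgression N ψ x ∧ ∀ σ : N, (σ : G) ∈ M → ψ σ = 1)
    (hM : ∀ σ : N, (∀ x ∈ B, ∀ ψ : N →ₜ* Multiplicative (ZMod p),
      IsTransgression N ψ x → ψ σ = 1) → (σ : G) ∈ M) :
    (∃ β : Additive (N ⧸ M.subgroupOf N) →+ B →+ ZMod p,
      IsPerfectPairing β ∧
      ∀ (x : B) (ψ : N →ₜ* Multiplicative (ZMod p)),
        IsTransgression N ψ (x : contH2 (G ⧸ N) (ZMod p)) ↔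
          ∀ σ : N, β (Additive.ofMul (QuotientGroup.mk σ)) x = (ψ σ).toAdd) ∧
    (Function.Injective B.subtype ∧
      Function.Exact B.subtype (contH2.map (ZMod p) (quotMap hMN))) := by
  have hcompact : CompactSpace N := isCompact_iff_compactSpace.1 hclosed.isCompact
  -- `Ψ` inverts transgression on `B`; uniqueness makes it additive.
  choose Ψ hΨ hΨM using fun x : B => hB x x.2
  have hΨadd (x x' : B) : Ψ (x + x') = Ψ x * Ψ x' :=
    (hΨ (x + x')).unique_left hN ((hΨ x).mul (hΨ x'))
  let Φ (x : B) : N ⧸ M.subgroupOf N →ₜ* Multiplicative (ZMod p) :=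
    (Ψ x).quotientLift fun σ hσ => hΨM x σ hσ
  let β : Additive (N ⧸ M.subgroupOf N) →+ B →+ ZMod p :=
    AddMonoidHom.mk'
      (fun a => AddMonoidHom.mk' (fun x => (Φ x a.toMul).toAdd) fun x x' => by
        induction a using Additive.rec with | _ a
        induction a using QuotientGroup.induction_on with | _ σ
        change (Ψ (x + x') σ).toAdd = (Ψ x σ * Ψ x' σ).toAdd
        rw [hΨadd]
        rfl)
      fun a a' => by
        ext x
        exact congrArg Multiplicative.toAdd (map_mul (Φ x) a.toMul a'.toMul)
  have hβ (σ : N) (x : B) : β (Additive.ofMul (QuotientGroup.mk σ)) x = (Ψ x σ).toAdd := rfl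
  have hcont (x : B) : Continuous fun a => β a x :=
    continuous_toAdd.comp ((map_continuous (Φ x)).comp continuous_toMul)
  have hperf : IsPerfectPairing β := by
    refine isPerfectPairing_of_nondegenerate β hcont (fun a ha => ?_) fun x hx => ?_
    · induction a using Additive.rec with | _ a
      induction a using QuotientGroup.induction_on with | _ σ
      refine congrArg Additive.ofMul ((QuotientGroup.eq_one_iff σ).2 ?_)
      refine Subgroup.mem_subgroupOf.2 (hM σ fun x hx ψ hψ => ?_)
      rw [hψ.unique_left hN (hΨ ⟨x, hx⟩)]
      exact ha ⟨x, hx⟩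
    · have h1 : Ψ x = 1 := ContinuousMonoidHom.ext fun σ => hx (Additive.ofMul (σ : N ⧸ _))
      have h2 := hΨ x
      rw [h1] at h2
      exact Subtype.ext h2.eq_zero
  refine ⟨⟨β, hperf, fun x ψ => ⟨fun h σ => ?_, fun h => ?_⟩⟩, B.subtype_injective, fun x => ?_⟩
  · rw [hβ, h.unique_left hN (hΨ x)]
  · have : ψ = Ψ x := ContinuousMonoidHom.ext fun σ => (h σ).symm
    rw [this]
    exact hΨ x
  · constructor
    · intro hx
      -- `ψ` descends to a continuous functional on `N/M`, so perfectness gives `ψ = Ψ b`, and both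
      -- `b` and `x` are its transgression.
      obtain ⟨ψ, hψ, hψM⟩ := exists_isTransgression_of_map_quotMap_eq_zero hMN hx
      let Q : N ⧸ M.subgroupOf N →ₜ* Multiplicative (ZMod p) :=
        ψ.quotientLift fun σ hσ => hψM σ hσ
      let f : Additive (N ⧸ M.subgroupOf N) →ₜ+ ZMod p :=
        ⟨AddMonoidHom.mk' (fun a => (Q a.toMul).toAdd) fun a a' =>
            congrArg Multiplicative.toAdd (map_mul Q a.toMul a'.toMul),
          continuous_toAdd.comp ((map_continuous Q).comp continuous_toMul)⟩
      obtain ⟨b, hb⟩ := hperf.bijective_right.2 f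
      have h1 : Ψ b = ψ := ContinuousMonoidHom.ext fun σ =>
        DFunLike.congr_fun hb (Additive.ofMul (σ : N ⧸ M.subgroupOf N))
      have h2 := hΨ b
      rw [h1] at h2
      exact ⟨b, h2.unique_right hψ⟩
    · rintro ⟨b, rfl⟩
      exact (hΨ b).map_quotMap_eq_zero hMN (hΨM b)

theorem isClosed_kernelInter {U : Type*} [Group U] [TopologicalSpace U] [T1Space U] :
    IsClosed (kernelInter U G : Set G) := by
  rw [kernelInter, Subgroup.coe_iInf]
  exact isClosed_iInter fun ρ => isClosed_singleton.preimage (map_continuous ρ)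

theorem exists_isTransgression_of_mem_masseyPart {m : ℕ}
    {x : contH2 (G ⧸ TU p (m + 1) G) (ZMod p)} (hx : x ∈ masseyPart p (m + 2) G) :
    ∃ ψ : TU p (m + 1) G →ₜ* Multiplicative (ZMod p),
      IsTransgression (TU p (m + 1) G) ψ x ∧ ∀ σ : TU p (m + 1) G, (σ : G) ∈ TU p (m + 2) G → ψ σ = 1 := by
  refine AddSubgroup.closure_induction (p := fun x _ =>
    ∃ ψ : TU p (m + 1) G →ₜ* Multiplicative (ZMod p),
      IsTransgression (TU p (m + 1) G) ψ x ∧ ∀ σ : TU p (m + 1) G, (σ : G) ∈ TU p (m + 2) G → ψ σ = 1)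
    ?_ ?_ ?_ ?_ hx
  · rintro x ⟨⟨ρ', rfl⟩, h⟩
    -- The class dies only after inflation to `G`, so the lift to `U_{m+2}` is defined on `G`, and
    -- its corner can be nontrivial on `TU p (m + 1) G`.
    obtain ⟨ρ, hρ⟩ := exists_lift_of_map_classifyingClass_eq_zero (n := m + 1) (R := ZMod p)
      (ρ'.comp (quotProj (TU p (m + 1) G))) h
    refine ⟨(cornerHom ρ)⁻¹, isTransgression_cornerHom ρ ρ' hρ, fun σ hσ => ?_⟩
    refine inv_eq_one.2 (Multiplicative.toAdd.injective ?_)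
    refine (cornerHom_apply ρ σ).trans ?_
    rw [eq_one_of_mem_kernelInter hσ]
    exact uCorner_one
  · exact ⟨1, .one, fun _ _ => rfl⟩
  · rintro x x' - - ⟨ψ, hψ, h⟩ ⟨ψ', hψ', h'⟩
    refine ⟨ψ * ψ', hψ.mul hψ', fun σ hσ => ?_⟩
    change ψ σ * ψ' σ = 1
    rw [h σ hσ, h' σ hσ, one_mul]
  · rintro x - ⟨ψ, hψ, h⟩
    refine ⟨ψ⁻¹, hψ.inv, fun σ hσ => ?_⟩
    change (ψ σ)⁻¹ = 1
    rw [h σ hσ, inv_one]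

/-- The cochain on `G` witnessing the transgression bounds the inflated class. These classes suffice
to detect `TU p (m + 2) G`. -/
theorem map_unitriangularBarHom_mem_masseyPart {m : ℕ}
    (ρ : G →ₜ* unitriangular (m + 2) (ZMod p)) :
    contH2.map (ZMod p) (unitriangularBarHom ρ) (classifyingClass (m + 2) (ZMod p)) ∈
      masseyPart p (m + 2) G := by
  refine AddSubgroup.subset_closure ⟨⟨unitriangularBarHom ρ, rfl⟩, ?_⟩
  obtain ⟨-, y, c, hy, -, hc, h⟩ :=
    isTransgression_cornerHom ρ (unitriangularBarHom ρ) fun _ => rfl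
  rw [← h]
  exact (contH2.mk_eq_zero_iff _).2 ⟨y, hy, hc⟩

end Pairing

theorem theorem9p1 (p : ℕ) [Fact p.Prime] (n : ℕ) (hn : 2 ≤ n)
    (G : Type*) [Group G] [TopologicalSpace G] [IsTopologicalGroup G] [CompactSpace G]
    [TotallyDisconnectedSpace G] :
    (∃ β : Additive (TU p (n - 1) G ⧸ (TU p n G).subgroupOf (TU p (n - 1) G)) →+
        masseyPart p n G →+ ZMod p,
      IsPerfectPairing β ∧
      ∀ (x : masseyPart p n G) (ψ : TU p (n - 1) G →ₜ* Multiplicative (ZMod p)),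
        IsTransgression (TU p (n - 1) G) ψ (x : contH2 (G ⧸ TU p (n - 1) G) (ZMod p)) ↔
          ∀ σ : TU p (n - 1) G, β (Additive.ofMul (QuotientGroup.mk σ)) x = (ψ σ).toAdd) ∧
    (Function.Injective (masseyPart p n G).subtype ∧
      Function.Exact (masseyPart p n G).subtype
        (contH2.map (ZMod p)
          (quotMap (kernelInter_unitriangular_le_pred n (ZMod p) G)))) := by
  -- Now `n - 1 = m + 1` is positive, as `hom_eq_one_of_mem_kernelInter` requires.
  obtain ⟨m, rfl⟩ := Nat.exists_eq_add_of_le' hn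
  refine exists_perfect_transgression_pairing (N := TU p (m + 1) G) (M := TU p (m + 2) G) _
    isClosed_kernelInter (fun χ σ hσ => hom_eq_one_of_mem_kernelInter hσ χ)
    (masseyPart p (m + 2) G) (fun x hx => exists_isTransgression_of_mem_masseyPart hx)
    fun σ hσ => ?_
  -- Since `ρ σ` is central, it is trivial once its corner is, and that corner is tested by the
  -- Massey class of `ρ`.
  refine Subgroup.mem_iInf.2 fun ρ => eq_one_of_cornerHom_eq_one (ρ := ρ) ?_
  exact inv_eq_one.1 (hσ _ (map_unitriangularBarHom_mem_masseyPart ρ) _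
    (isTransgression_cornerHom ρ (unitriangularBarHom ρ) fun _ => rfl))
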